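/- Let $K$ be an infinite field of characteristic different from $2$ and $3$, and let $n\ge 3$ be an integer. All algebras are associative with unit $1$ over $K$. Put $[x_1,x_2]=x_1x_2-x_2x_1$ and, inductively, $[x_1,\dots,x_m]=[[x_1,\dots,x_{m-1}],x_m]$. For an algebra $A$ and $m\ge 2$ let $T^{(m)}(A)$ be the T-ideal of $A$ generated by the commutator $[x_1,\dots,x_m]$, i.e. the two-sided ideal of $A$ generated by all elements $[a_1,\dots,a_m]$ with $a_1,\dots,a_m\in A$. Let $F$ be the free algebra on the countable set $X=\{x_1,x_2,\dots\}$, let $F^{(n)}=F/T^{(n)}(F)$ be the relatively free algebra with the identity $[x_1,\dots,x_n]=0$, and let $F_3^{(n)}$ be the (unital) subalgebra of $F^{(n)}$ generated by the images of $x_1,x_2,x_3$. Then $$T^{(n-1)}\bigl(F_3^{(n)}\bigr)\subseteq Z\bigl(F_3^{(n)}\bigr),$$ where $Z(A)$ denotes the center of an algebra $A$. -/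

import Mathlib

namespace LieNilp

universe u v

/-- The left-normed commutator `[a₁, …, aₙ]` of the first `n` terms of a sequence `a`
(whose terms are numbered from `0` in the code): `[a₁, a₂] = a₁ a₂ - a₂ a₁` and
`[a₁, …, aₙ] = [[a₁, …, aₙ₋₁], aₙ]`. By convention it is `a₁` for `n = 1` and `0` for `n = 0`. -/
def comm {A : Type v} [Ring A] (a : ℕ → A) : ℕ → A
  | 0 => 0
  | 1 => a 0
  | k + 2 => comm a (k + 1) * a (k + 1) - a (k + 1) * comm a (k + 1)

variable (K : Type u) [Field K]

/-- The free associative unital algebra `F` on a countable set `X` of free generators. -/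
abbrev F : Type u := FreeAlgebra K ℕ

/-- The polynomial `[x₁, …, xₙ]` of `F`. -/
def commPoly (n : ℕ) : F K := comm (FreeAlgebra.ι K) n

variable {K} in
/-- The T-ideal of an algebra `A` generated by a polynomial `f ∈ F`: the two-sided ideal of `A`
generated by all values of `f` in `A`. For `A = F` this is the least two-sided ideal
that contains `f` and is stable under all endomorphisms, see `tIdeal_free_isLeast`. -/
def tIdeal (f : F K) (A : Type v) [Ring A] [Algebra K A] : TwoSidedIdeal A :=
  TwoSidedIdeal.span (Set.range fun φ : F K →ₐ[K] A => φ f)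

/-- `T⁽ⁿ⁾(A)`: the T-ideal of `A` generated by the commutator `[x₁, …, xₙ]`. -/
def T (n : ℕ) (A : Type v) [Ring A] [Algebra K A] : TwoSidedIdeal A :=
  tIdeal (commPoly K n) A

/-- `F⁽ⁿ⁾ = F / T⁽ⁿ⁾`, the relatively free algebra with the identity `[x₁, …, xₙ] = 0`. -/
abbrev RelFree (n : ℕ) : Type u := (T K n (F K)).ringCon.Quotient

/-- The canonical generators of `F⁽ⁿ⁾` (numbered from `0` in the code). -/
def RelFree.gen (n i : ℕ) : RelFree K n := (T K n (F K)).ringCon.mk' (FreeAlgebra.ι K i)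

/-- `F₃⁽ⁿ⁾`: the unital subalgebra of `F⁽ⁿ⁾` generated by `X₃ = {x₁, x₂, x₃}`. -/
def F₃ (n : ℕ) : Subalgebra K (RelFree K n) :=
  Algebra.adjoin K {RelFree.gen K n 0, RelFree.gen K n 1, RelFree.gen K n 2}

variable {K}

/-- On the free algebra, `tIdeal f F` is the T-ideal generated by `f` in the usual sense. -/
theorem tIdeal_free_isLeast (f : F K) :
    IsLeast {I : TwoSidedIdeal (F K) | f ∈ I ∧ ∀ φ : F K →ₐ[K] F K, ∀ g ∈ I, φ g ∈ I}
      (tIdeal f (F K)) := by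
  refine ⟨⟨TwoSidedIdeal.subset_span ⟨AlgHom.id K _, rfl⟩, fun φ g hg => ?_⟩, fun I hI => ?_⟩
  · have h : tIdeal f (F K) ≤ (tIdeal f (F K)).comap φ := by
      refine TwoSidedIdeal.span_le.2 ?_
      rintro _ ⟨ψ, rfl⟩
      exact (TwoSidedIdeal.mem_comap φ).2 (TwoSidedIdeal.subset_span ⟨φ.comp ψ, rfl⟩)
    exact (TwoSidedIdeal.mem_comap φ).1 (h hg)
  · refine TwoSidedIdeal.span_le.2 ?_
    rintro _ ⟨ψ, rfl⟩
    exact hI.2 ψ f hI.1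

end LieNilp

namespace LieNilp

/-! Write T⁽ᵐ⁾ for T⁽ᵐ⁾(A), with T⁽¹⁾ = A. It suffices that T⁽²⁾T⁽ᵐ⁾ ⊆ T⁽ᵐ⁺¹⁾ in every algebra with
three generators: taking m = n - 1 and T⁽ⁿ⁾ = 0, both terms of [pv, b] = p[v, b] + [p, b]v vanish
for a commutator v of length n - 1 (`commute_of_mem_span`).

The inclusion is proved by induction on m in steps of two (`lie_mul_mem_span_commSet`). The case m =
1 is trivial. For m = 2, modulo T⁽³⁾ the product [v, a][b, c] is alternating and satisfies a Leibniz
rule in each argument, so it vanishes: three generators cannot fill four slots without repetition.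
The step from m to m + 2 needs no bound on the generators: modulo T⁽ᵐ⁺³⁾, for s of length m, [s, a,
b][c, d] is alternating in a, b, c, d and satisfies a Jacobi relation, so three times it is 0
(`lie_lie_mul_lie_eq_zero`). -/

/-- The set of values of the left-normed commutators of length `k + 1` in a ring. -/
def commSet (R : Type*) [Ring R] : ℕ → Set R
  | 0 => Set.univ
  | k + 1 => {r | ∃ l ∈ commSet R k, ∃ a, ⁅l, a⁆ = r}

/-! ### Identities in Lie nilpotent rings -/

section Ring

variable {R : Type*} [Ring R]

theorem lie_mem_commSet {k : ℕ} {l : R} (hl : l ∈ commSet R k) (a : R) :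
    ⁅l, a⁆ ∈ commSet R (k + 1) :=
  ⟨l, hl, a, rfl⟩

theorem commSet_succ_subset (k : ℕ) : commSet R (k + 1) ⊆ commSet R k := by
  induction k with
  | zero => exact fun _ _ => Set.mem_univ _
  | succ k ih =>
    rintro _ ⟨l, hl, a, rfl⟩
    exact lie_mem_commSet (ih hl) a

theorem map_mem_commSet {S : Type*} [Ring S] (f : R →+* S) {k : ℕ} {l : R}
    (hl : l ∈ commSet R k) : f l ∈ commSet S k := by
  induction k generalizing l with
  | zero => exact Set.mem_univ _
  | succ k ih =>
    obtain ⟨l, hl, a, rfl⟩ := hl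
    refine ⟨f l, ih hl, f a, ?_⟩
    simp [Ring.lie_def]

theorem exists_lift_commSet {S : Type*} [Ring S] {f : R →+* S} (hf : Function.Surjective f)
    {k : ℕ} {s : S} (hs : s ∈ commSet S k) : ∃ l ∈ commSet R k, f l = s := by
  induction k generalizing s with
  | zero =>
    obtain ⟨l, rfl⟩ := hf s
    exact ⟨l, Set.mem_univ _, rfl⟩
  | succ k ih =>
    obtain ⟨s, hs, b, rfl⟩ := hs
    obtain ⟨l, hl, rfl⟩ := ih hs
    obtain ⟨a, rfl⟩ := hf b
    exact ⟨_, lie_mem_commSet hl a, by simp [Ring.lie_def]⟩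

/-- Since vb = bv + [v, b] and [v, b] is again such a commutator, the left ideal absorbs right
factors. -/
instance isTwoSided_span_commSet (k : ℕ) : (Ideal.span (commSet R k)).IsTwoSided := by
  refine ⟨fun {a} b ha => ?_⟩
  induction ha using Submodule.span_induction with
  | mem v hv =>
    have h : v * b = b * v + ⁅v, b⁆ := by rw [Ring.lie_def]; abel
    rw [h]
    exact add_mem (Ideal.mul_mem_left _ _ (Ideal.subset_span hv))
      (Ideal.subset_span (commSet_succ_subset k (lie_mem_commSet hv b)))
  | zero => simp
  | add x y _ _ hx hy => rw [add_mul]; exact add_mem hx hy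
  | smul r x _ hx => rw [smul_eq_mul, mul_assoc]; exact Ideal.mul_mem_left _ _ hx

/-- Expand [v, ab, c] = 0 by the Leibniz rule; [v, b] is central, so the two mixed terms can be
compared. -/
theorem lie_mul_lie_swap {k : ℕ} (hR : ∀ r ∈ commSet R (k + 2), r = 0) {v : R}
    (hv : v ∈ commSet R k) (a b c : R) : ⁅v, a⁆ * ⁅b, c⁆ = -(⁅v, b⁆ * ⁅a, c⁆) := by
  have hz : ∀ x y : R, ⁅⁅v, x⁆, y⁆ = 0 := fun x y =>
    hR _ (lie_mem_commSet (lie_mem_commSet hv x) y)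
  have h₁ := hz (a * b) c
  have h₂ := hz a c
  have h₃ := hz b c
  have h₄ := hz b ⁅a, c⁆
  simp only [Ring.lie_def] at *
  linear_combination (norm := noncomm_ring) h₁ - a * h₃ - h₂ * b + h₄

theorem ring_lie_skew (a b : R) : ⁅a, b⁆ = -⁅b, a⁆ := by
  simp only [Ring.lie_def]; abel

theorem lie_mul_lie_rotate {k : ℕ} (hR : ∀ r ∈ commSet R (k + 2), r = 0) {v : R}
    (hv : v ∈ commSet R k) (a b c : R) : ⁅v, a⁆ * ⁅b, c⁆ = ⁅v, b⁆ * ⁅c, a⁆ := by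
  rw [lie_mul_lie_swap hR hv, ring_lie_skew c a, mul_neg]

theorem lie_mul_lie_self {k : ℕ} (hR : ∀ r ∈ commSet R (k + 2), r = 0) {v : R}
    (hv : v ∈ commSet R k) (a c : R) : ⁅v, a⁆ * ⁅a, c⁆ = 0 := by
  rw [lie_mul_lie_rotate hR hv, lie_mul_lie_rotate hR hv, Ring.lie_def a a, sub_self, mul_zero]

/-- This is T⁽³⁾T⁽ᵐ⁾ ⊆ T⁽ᵐ⁺²⁾. For v = [u, b], expanding [u, ab, c, d] = 0 makes [a, c, d][u, b]
skew in a, b; with the Jacobi identity it becomes alternating in all four, and Jacobi then reads 3x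
= 0. -/
theorem triple_lie_mul_eq_zero (h3 : ∀ r : R, 3 * r = 0 → r = 0) {k : ℕ}
    (hR : ∀ r ∈ commSet R (k + 2), r = 0) {v : R} (hv : v ∈ commSet R k) (a c d : R) :
    ⁅⁅a, c⁆, d⁆ * v = 0 := by
  cases k with
  | zero =>
    rw [hR _ (lie_mem_commSet (lie_mem_commSet (Set.mem_univ a) c) d), zero_mul]
  | succ k =>
    obtain ⟨u, hu, b, rfl⟩ := hv
    have hz : ∀ x y z : R, ⁅⁅⁅u, x⁆, y⁆, z⁆ = 0 := fun x y z =>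
      hR _ (lie_mem_commSet (lie_mem_commSet (lie_mem_commSet hu x) y) z)
    have hskew : ∀ a b c d : R, ⁅⁅a, c⁆, d⁆ * ⁅u, b⁆ = -(⁅⁅b, c⁆, d⁆ * ⁅u, a⁆) := by
      intro a b c d
      have h₁ := hz (a * b) c d
      have h₂ := hz a c d
      have h₃ := hz b c d
      have h₄ := hz b c ⁅a, d⁆
      have h₅ := hz b d ⁅a, c⁆
      have h₁₀ : ⁅⁅u, a⁆, ⁅⁅b, c⁆, d⁆⁆ = 0 := by
        have e₁ := hz a b c
        have e₂ := hz a ⁅b, c⁆ d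
        have e₃ := hz a d ⁅b, c⁆
        simp only [Ring.lie_def] at *
        linear_combination (norm := noncomm_ring) e₂ - e₃
      have h₁₁ : ⁅⁅u, a⁆, d⁆ * ⁅b, c⁆ + ⁅⁅u, a⁆, c⁆ * ⁅b, d⁆ = 0 := by
        rw [lie_mul_lie_rotate hR (lie_mem_commSet hu a) d,
          lie_mul_lie_rotate hR (lie_mem_commSet hu a) c, ring_lie_skew d c, mul_neg,
          add_neg_cancel]
      have h₁₂ : ⁅⁅u, b⁆, d⁆ * ⁅a, c⁆ + ⁅⁅u, b⁆, c⁆ * ⁅a, d⁆ = 0 := by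
        rw [lie_mul_lie_rotate hR (lie_mem_commSet hu b) d,
          lie_mul_lie_rotate hR (lie_mem_commSet hu b) c, ring_lie_skew d c, mul_neg,
          add_neg_cancel]
      simp only [Ring.lie_def] at *
      linear_combination (norm := noncomm_ring) h₁ - a * h₃ - h₂ * b - h₁₁ - h₁₂ + h₄ + h₅ - h₁₀
    have hjac : ∀ a c d b : R, ⁅⁅a, c⁆, d⁆ * ⁅u, b⁆ + ⁅⁅c, d⁆, a⁆ * ⁅u, b⁆
        + ⁅⁅d, a⁆, c⁆ * ⁅u, b⁆ = 0 := by
      intro a c d b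
      simp only [Ring.lie_def]
      noncomm_ring
    have h12 : ∀ a b c d : R, ⁅⁅a, c⁆, d⁆ * ⁅u, b⁆ = -(⁅⁅c, a⁆, d⁆ * ⁅u, b⁆) := by
      intro a b c d
      simp only [Ring.lie_def]
      noncomm_ring
    have hself : ∀ a c b : R, ⁅⁅a, c⁆, b⁆ * ⁅u, b⁆ = 0 := by
      intro a c b
      have h := hjac a c b b
      have hb : ∀ x y : R, ⁅⁅b, b⁆, x⁆ * ⁅u, y⁆ = 0 := by
        intro x y
        simp [Ring.lie_def]
      rw [hskew c b b a, h12 b b a c, hskew a b b c, hb, hb] at h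
      simpa using h
    have h34 : ∀ a b c d : R, ⁅⁅a, c⁆, d⁆ * ⁅u, b⁆ = -(⁅⁅a, c⁆, b⁆ * ⁅u, d⁆) := by
      intro a b c d
      have h₁ := hself a c (b + d)
      have h₂ := hself a c b
      have h₃ := hself a c d
      simp only [Ring.lie_def] at *
      linear_combination (norm := noncomm_ring) h₁ - h₂ - h₃
    have hrot : ∀ a b c d : R, ⁅⁅c, d⁆, a⁆ * ⁅u, b⁆ = ⁅⁅a, c⁆, d⁆ * ⁅u, b⁆ := by
      intro a b c d
      rw [h34 c b d a, hskew c a d b, h34 a c d b, h12 a b d c, h34 d b a c, hskew d c a b,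
        h34 c d a b, h12 c b a d]
      simp only [neg_neg]
    apply h3
    have h := hjac a c d b
    rw [hrot c b d a, hrot a b c d] at h
    rw [← h]
    noncomm_ring

/-- In the expansion of [pv, a, b], the term [p, a, b]v dies by `triple_lie_mul_eq_zero` and the two
mixed terms cancel by skew symmetry. -/
theorem lie_lie_eq_zero_of_mem_span (h3 : ∀ r : R, 3 * r = 0 → r = 0) {k : ℕ}
    (hR : ∀ r ∈ commSet R (k + 2), r = 0) {t : R} (ht : t ∈ Ideal.span (commSet R k)) (a b : R) :
    ⁅⁅t, a⁆, b⁆ = 0 := by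
  induction ht using Submodule.closure_induction with
  | zero => simp [Ring.lie_def]
  | add x y _ _ hx hy =>
    simp only [Ring.lie_def] at *
    linear_combination (norm := noncomm_ring) hx + hy
  | smul_mem p v hv =>
    have h₁ := hR _ (lie_mem_commSet (lie_mem_commSet hv a) b)
    have h₂ := triple_lie_mul_eq_zero h3 hR hv p a b
    have h₅ := hR _ (lie_mem_commSet (lie_mem_commSet hv b) ⁅p, a⁆)
    have h₆ := hR _ (lie_mem_commSet (lie_mem_commSet hv a) ⁅p, b⁆)
    have h₇ : ⁅v, b⁆ * ⁅p, a⁆ = -(⁅v, a⁆ * ⁅p, b⁆) := by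
      rw [← lie_mul_lie_rotate hR hv a b p, ring_lie_skew b p, mul_neg]
    simp only [Ring.lie_def, smul_eq_mul] at *
    linear_combination (norm := noncomm_ring) p * h₁ + h₂ + h₇ - h₅ - h₆

/-- Products of a commutator with a commutator of length `k + 3`, in a ring where commutators of
length `k + 4` vanish. -/
theorem lie_lie_mul_lie_eq_zero (h3 : ∀ r : R, 3 * r = 0 → r = 0) {k : ℕ}
    (hR : ∀ r ∈ commSet R (k + 3), r = 0)
    (hmul : ∀ c d : R, ∀ s ∈ commSet R k, ⁅c, d⁆ * s ∈ Ideal.span (commSet R (k + 1)))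
    {s : R} (hs : s ∈ commSet R k) (a b c d : R) : ⁅⁅s, a⁆, b⁆ * ⁅c, d⁆ = 0 := by
  have hrot : ∀ a b c d : R, ⁅⁅s, a⁆, b⁆ * ⁅c, d⁆ = ⁅⁅s, a⁆, c⁆ * ⁅d, b⁆ := fun a =>
    lie_mul_lie_rotate hR (lie_mem_commSet hs a)
  have hself : ∀ a b d : R, ⁅⁅s, a⁆, b⁆ * ⁅b, d⁆ = 0 := fun a =>
    lie_mul_lie_self hR (lie_mem_commSet hs a)
  have hskew : ∀ a b c d : R, ⁅⁅s, a⁆, b⁆ * ⁅c, d⁆ = -(⁅⁅s, a⁆, b⁆ * ⁅d, c⁆) := by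
    intro a b c d
    rw [ring_lie_skew c d, mul_neg]
  -- By `hmul`, [[c, d]s, a, b] = 0; the mixed terms of its expansion contain a triple commutator
  -- and vanish.
  have hdual : ∀ a b c d : R, ⁅⁅⁅c, d⁆, a⁆, b⁆ * s = -(⁅⁅s, a⁆, b⁆ * ⁅c, d⁆) := by
    intro a b c d
    have h₁ := lie_lie_eq_zero_of_mem_span h3 hR (hmul c d s hs) a b
    have h₂ := triple_lie_mul_eq_zero h3 hR (lie_mem_commSet hs b) c d a
    have h₃ := triple_lie_mul_eq_zero h3 hR (lie_mem_commSet hs a) c d b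
    have h₄ : ⁅⁅⁅s, a⁆, b⁆, ⁅c, d⁆⁆ = 0 :=
      hR _ (lie_mem_commSet (lie_mem_commSet (lie_mem_commSet hs a) b) _)
    simp only [Ring.lie_def] at *
    linear_combination (norm := noncomm_ring) h₁ - h₂ - h₃ + h₄
  -- Sum `hdual` cyclically over a, c, d: the left sides cancel by Jacobi.
  have hjac : ∀ a b c d : R, ⁅⁅s, a⁆, b⁆ * ⁅c, d⁆ + ⁅⁅s, c⁆, b⁆ * ⁅d, a⁆
      + ⁅⁅s, d⁆, b⁆ * ⁅a, c⁆ = 0 := by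
    intro a b c d
    have h₁ := hdual a b c d
    have h₂ := hdual c b d a
    have h₃ := hdual d b a c
    clear hmul hrot hself hskew hdual
    simp only [Ring.lie_def] at *
    linear_combination (norm := noncomm_ring) h₁ + h₂ + h₃
  have hzero : ∀ b c d : R, ⁅⁅s, b⁆, b⁆ * ⁅c, d⁆ = 0 := by
    intro b c d
    have h := hjac b b c d
    rw [hskew c b d b, hself, hself] at h
    simpa using h
  have hswap : ∀ a b c d : R, ⁅⁅s, a⁆, b⁆ * ⁅c, d⁆ = -(⁅⁅s, b⁆, a⁆ * ⁅c, d⁆) := by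
    intro a b c d
    have h₁ := hzero (a + b) c d
    have h₂ := hzero a c d
    have h₃ := hzero b c d
    simp only [Ring.lie_def] at *
    linear_combination (norm := noncomm_ring) h₁ - h₂ - h₃
  have h := hjac a b c d
  have e₁ : ⁅⁅s, c⁆, b⁆ * ⁅d, a⁆ = ⁅⁅s, a⁆, b⁆ * ⁅c, d⁆ := by
    rw [hswap c b d a, ← hrot b a c d, hswap b a c d, neg_neg]
  have e₂ : ⁅⁅s, d⁆, b⁆ * ⁅a, c⁆ = ⁅⁅s, a⁆, b⁆ * ⁅c, d⁆ := by
    rw [hswap d b a c, hrot b d a c, hswap b a c d, neg_neg]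
  rw [e₁, e₂] at h
  apply h3
  rw [← h]
  noncomm_ring

end Ring

/-! ### Passage to quotients and the three-generator case -/

section Quotient

variable {A : Type*} [Ring A]

theorem quotient_commSet_eq_zero {k : ℕ} :
    ∀ r ∈ commSet (A ⧸ Ideal.span (commSet A k)) k, r = 0 := by
  intro r hr
  obtain ⟨l, hl, rfl⟩ := exists_lift_commSet (f := Ideal.Quotient.mk _)
    Ideal.Quotient.mk_surjective hr
  exact Ideal.Quotient.eq_zero_iff_mem.2 (Ideal.subset_span hl)

/-- `T⁽²⁾ T⁽ᵐ⁾ ⊆ T⁽ᵐ⁺¹⁾` implies `T⁽²⁾ T⁽ᵐ⁺²⁾ ⊆ T⁽ᵐ⁺³⁾`. -/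
theorem mul_lie_mem_span_add_two (K : Type*) [Field K] [Algebra K A] (h3 : (3 : K) ≠ 0) {k : ℕ}
    (h : ∀ c d : A, ∀ s ∈ commSet A k, ⁅c, d⁆ * s ∈ Ideal.span (commSet A (k + 1)))
    {v : A} (hv : v ∈ commSet A (k + 2)) (c d : A) :
    v * ⁅c, d⁆ ∈ Ideal.span (commSet A (k + 3)) := by
  obtain ⟨_, ⟨s, hs, a, rfl⟩, b, rfl⟩ := hv
  rw [← Ideal.Quotient.eq_zero_iff_mem]
  have h3' : ∀ r : A ⧸ Ideal.span (commSet A (k + 3)), 3 * r = 0 → r = 0 := by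
    intro r hr
    have : (3 : K) • r = 0 := by
      rw [Algebra.smul_def, map_ofNat, hr]
    exact (smul_eq_zero.1 this).resolve_left h3
  have key := lie_lie_mul_lie_eq_zero h3' quotient_commSet_eq_zero (fun c d s' hs' => ?_)
    (map_mem_commSet (Ideal.Quotient.mk (Ideal.span (commSet A (k + 3)))) hs)
    (Ideal.Quotient.mk _ a) (Ideal.Quotient.mk _ b) (Ideal.Quotient.mk _ c) (Ideal.Quotient.mk _ d)
  · simpa only [Ring.lie_def, map_mul, map_sub] using key
  · obtain ⟨c, rfl⟩ := Ideal.Quotient.mk_surjective c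
    obtain ⟨d, rfl⟩ := Ideal.Quotient.mk_surjective d
    obtain ⟨t, ht, rfl⟩ := exists_lift_commSet (f := Ideal.Quotient.mk _)
      Ideal.Quotient.mk_surjective hs'
    have hmem := Ideal.mem_map_of_mem (Ideal.Quotient.mk (Ideal.span (commSet A (k + 3))))
      (h c d t ht)
    rw [Ideal.map_span] at hmem
    have hsub : Ideal.Quotient.mk (Ideal.span (commSet A (k + 3))) '' commSet A (k + 1) ⊆
        commSet (A ⧸ Ideal.span (commSet A (k + 3))) (k + 1) := by
      rintro _ ⟨l, hl, rfl⟩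
      exact map_mem_commSet _ hl
    simpa only [Ring.lie_def, map_mul, map_sub] using Ideal.span_mono hsub hmem

theorem lie_mul_lie_eq_zero_of_generators {K : Type*} [Field K] [Algebra K A]
    (hA₂ : ∀ r ∈ commSet A 2, r = 0) {x y z : A} (hA : Algebra.adjoin K {x, y, z} = ⊤)
    (v a b c : A) : ⁅v, a⁆ * ⁅b, c⁆ = 0 := by
  have hz : ∀ a b c : A, ⁅⁅a, b⁆, c⁆ = 0 := fun a b c =>
    hA₂ _ (lie_mem_commSet (lie_mem_commSet (Set.mem_univ a) b) c)
  have hswap : ∀ v a b c : A, ⁅v, a⁆ * ⁅b, c⁆ = -(⁅v, b⁆ * ⁅a, c⁆) := fun v =>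
    lie_mul_lie_swap hA₂ (Set.mem_univ v)
  have hrot : ∀ v a b c : A, ⁅v, a⁆ * ⁅b, c⁆ = ⁅v, b⁆ * ⁅c, a⁆ := fun v =>
    lie_mul_lie_rotate hA₂ (Set.mem_univ v)
  have hself : ∀ v a c : A, ⁅v, a⁆ * ⁅a, c⁆ = 0 := fun v =>
    lie_mul_lie_self hA₂ (Set.mem_univ v)
  have hflip : ∀ v a b c : A, ⁅v, a⁆ * ⁅b, c⁆ = -(⁅a, v⁆ * ⁅b, c⁆) := by
    intro v a b c
    rw [ring_lie_skew v a, neg_mul]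
  have hmul : ∀ a b c v w : A, ⁅v, a⁆ * ⁅b, c⁆ = 0 → ⁅w, a⁆ * ⁅b, c⁆ = 0 →
      ⁅v * w, a⁆ * ⁅b, c⁆ = 0 := by
    intro a b c v w hv hw
    have h := hz v a w
    simp only [Ring.lie_def] at *
    linear_combination (norm := noncomm_ring) v * hw + h * (b * c - c * b) + w * hv
  have hext : ∀ a b c : A, (∀ v ∈ ({x, y, z} : Set A), ⁅v, a⁆ * ⁅b, c⁆ = 0) →
      ∀ v : A, ⁅v, a⁆ * ⁅b, c⁆ = 0 := by
    intro a b c h v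
    have hv : v ∈ Algebra.adjoin K {x, y, z} := hA ▸ Algebra.mem_top
    induction hv using Algebra.adjoin_induction with
    | mem v hv => exact h v hv
    | algebraMap r => rw [Ring.lie_def, Algebra.commutes, sub_self, zero_mul]
    | add v w _ _ hv hw =>
      simp only [Ring.lie_def] at *
      linear_combination (norm := noncomm_ring) hv + hw
    | mul v w _ _ hv hw => exact hmul a b c v w hv hw
  have h₁ : ∀ a ∈ ({x, y, z} : Set A), ∀ b ∈ ({x, y, z} : Set A), ∀ c ∈ ({x, y, z} : Set A),
      ∀ v : A, ⁅v, a⁆ * ⁅b, c⁆ = 0 := by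
    intro a ha b hb c hc
    refine hext a b c fun v hv => ?_
    have e₁ : ∀ a b c : A, ⁅a, a⁆ * ⁅b, c⁆ = 0 := fun a b c => by simp [Ring.lie_def]
    have e₂ : ∀ a b c : A, ⁅b, c⁆ * ⁅a, a⁆ = 0 := fun a b c => by simp [Ring.lie_def]
    have e₃ : ∀ a b c : A, ⁅a, b⁆ * ⁅a, c⁆ = 0 := fun a b c => by
      rw [hflip, hself, neg_zero]
    have e₄ : ∀ a b c : A, ⁅a, b⁆ * ⁅c, a⁆ = 0 := fun a b c => by
      rw [ring_lie_skew c a, mul_neg, e₃, neg_zero]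
    have e₅ : ∀ a b c : A, ⁅b, a⁆ * ⁅c, a⁆ = 0 := fun a b c => by
      rw [hflip, e₄, neg_zero]
    simp only [Set.mem_insert_iff, Set.mem_singleton_iff] at ha hb hc hv
    -- Four arguments among three generators: two coincide, and the six alternatives below are the
    -- six possible pairs of positions.
    rcases ha with rfl | rfl | rfl <;> rcases hb with rfl | rfl | rfl <;>
      rcases hc with rfl | rfl | rfl <;> rcases hv with rfl | rfl | rfl <;>
      first
      | exact e₁ _ _ _
      | exact e₂ _ _ _
      | exact e₃ _ _ _
      | exact e₄ _ _ _
      | exact e₅ _ _ _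
      | exact hself _ _ _
  -- `hext` frees only the first slot, so the other arguments are moved there in turn by skew
  -- symmetry.
  have h₂ : ∀ b ∈ ({x, y, z} : Set A), ∀ c ∈ ({x, y, z} : Set A),
      ∀ a v : A, ⁅v, a⁆ * ⁅b, c⁆ = 0 := by
    intro b hb c hc a v
    rw [hflip, hext v b c (fun w hw => ?_), neg_zero]
    rw [hflip, h₁ w hw b hb c hc, neg_zero]
  have h₃ : ∀ c ∈ ({x, y, z} : Set A), ∀ b a v : A, ⁅v, a⁆ * ⁅b, c⁆ = 0 := by
    intro c hc b a v
    rw [hswap, hflip, neg_neg, hext v a c (fun w hw => ?_)]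
    rw [hflip, hswap, neg_neg, h₂ w hw c hc]
  rw [hrot, hrot, hflip, hext v a b (fun w hw => ?_), neg_zero]
  rw [hflip, hrot, h₃ w hw, neg_zero]

theorem lie_mul_lie_mem_span_commSet {K : Type*} [Field K] [Algebra K A] {x y z : A}
    (hA : Algebra.adjoin K {x, y, z} = ⊤) (v a b c : A) :
    ⁅v, a⁆ * ⁅b, c⁆ ∈ Ideal.span (commSet A 2) := by
  rw [← Ideal.Quotient.eq_zero_iff_mem]
  let f : A →ₐ[K] A ⧸ Ideal.span (commSet A 2) := Ideal.Quotient.mkₐ K _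
  have hf : Algebra.adjoin K {f x, f y, f z} = ⊤ := by
    have h := congrArg (Subalgebra.map f) hA
    rw [AlgHom.map_adjoin, Algebra.map_top,
      (AlgHom.range_eq_top f).2 (Ideal.Quotient.mkₐ_surjective K _)] at h
    simpa only [Set.image_insert_eq, Set.image_singleton] using h
  have h := lie_mul_lie_eq_zero_of_generators quotient_commSet_eq_zero hf (f v) (f a) (f b) (f c)
  have e : f (⁅v, a⁆ * ⁅b, c⁆) = ⁅f v, f a⁆ * ⁅f b, f c⁆ := by
    simp only [Ring.lie_def, map_mul, map_sub]
  exact e.trans h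

theorem lie_mul_mem_span_commSet {K : Type*} [Field K] [Algebra K A] (h3 : (3 : K) ≠ 0) {x y z : A}
    (hA : Algebra.adjoin K {x, y, z} = ⊤) (k : ℕ) :
    ∀ c d : A, ∀ s ∈ commSet A k, ⁅c, d⁆ * s ∈ Ideal.span (commSet A (k + 1)) := by
  induction k using Nat.twoStepInduction with
  | zero =>
    intro c d s _
    exact Ideal.mul_mem_right _ _ (Ideal.subset_span (lie_mem_commSet (Set.mem_univ c) d))
  | one =>
    rintro c d _ ⟨v, -, a, rfl⟩
    exact lie_mul_lie_mem_span_commSet hA c d v a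
  | more k ih _ =>
    intro c d s hs
    have h₁ := mul_lie_mem_span_add_two K h3 ih hs c d
    have h₂ := Ideal.subset_span (α := A) (lie_mem_commSet hs ⁅c, d⁆)
    -- Reversing the factors costs only a longer commutator.
    have h₃ : ⁅c, d⁆ * s = s * ⁅c, d⁆ - ⁅s, ⁅c, d⁆⁆ := by
      rw [Ring.lie_def s]; abel
    rw [h₃]
    exact sub_mem h₁ h₂

theorem commute_of_mem_span {k : ℕ} (h0 : ∀ r ∈ commSet A (k + 1), r = 0)
    (hmul : ∀ c d : A, ∀ s ∈ commSet A k, ⁅c, d⁆ * s ∈ Ideal.span (commSet A (k + 1)))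
    {t : A} (ht : t ∈ Ideal.span (commSet A k)) (b : A) : b * t = t * b := by
  rw [Ideal.span_eq_bot.2 h0] at hmul
  induction ht using Submodule.closure_induction with
  | zero => simp
  | add t u _ _ ht hu => rw [mul_add, add_mul, ht, hu]
  | smul_mem p v hv =>
    have h₁ := h0 _ (lie_mem_commSet hv b)
    have h₂ : ⁅p, b⁆ * v = 0 := hmul p b v hv
    simp only [Ring.lie_def, smul_eq_mul] at *
    linear_combination (norm := noncomm_ring) -(p * h₁) - h₂

end Quotient

/-! ### Link with `comm`, `T` and `F₃` -/

theorem comm_mem_commSet {R : Type*} [Ring R] (a : ℕ → R) (k : ℕ) :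
    comm a (k + 1) ∈ commSet R k := by
  induction k with
  | zero => exact Set.mem_univ _
  | succ k ih => exact lie_mem_commSet ih _

theorem map_comm {R S : Type*} [Ring R] [Ring S] (f : R →+* S) (a : ℕ → R) (k : ℕ) :
    f (comm a k) = comm (fun i => f (a i)) k := by
  induction k with
  | zero => simp [comm]
  | succ k ih =>
    cases k with
    | zero => rfl
    | succ k => simp only [comm, map_sub, map_mul, ih]

theorem comm_congr {R : Type*} [Ring R] {a b : ℕ → R} {k : ℕ} (h : ∀ i < k, a i = b i) :
    comm a k = comm b k := by
  induction k with
  | zero => rfl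
  | succ k ih =>
    cases k with
    | zero => exact h 0 zero_lt_one
    | succ k => simp only [comm, ih fun i hi => h i (hi.trans (Nat.lt_succ_self _)),
        h (k + 1) (Nat.lt_succ_self _)]

theorem exists_comm_eq {R : Type*} [Ring R] {k : ℕ} {r : R} (hr : r ∈ commSet R k) :
    ∃ a : ℕ → R, comm a (k + 1) = r := by
  induction k generalizing r with
  | zero => exact ⟨fun _ => r, rfl⟩
  | succ k ih =>
    obtain ⟨l, hl, b, rfl⟩ := hr
    obtain ⟨a, rfl⟩ := ih hl
    -- `comm a (k + 1)` reads only indices up to k, so index k + 1 is free.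
    refine ⟨Function.update a (k + 1) b, ?_⟩
    have h : comm (Function.update a (k + 1) b) (k + 1) = comm a (k + 1) :=
      comm_congr fun i hi => Function.update_of_ne hi.ne _ _
    simp only [comm, h, Function.update_self, Ring.lie_def]

theorem T_subset_span {K A : Type*} [Field K] [Ring A] [Algebra K A] (k : ℕ) :
    (T K (k + 1) A : Set A) ⊆ Ideal.span (commSet A k) := by
  have h : T K (k + 1) A ≤ (Ideal.span (commSet A k)).toTwoSided := by
    refine TwoSidedIdeal.span_le.2 ?_
    rintro _ ⟨φ, rfl⟩
    refine Ideal.mem_toTwoSided.2 (Ideal.subset_span ?_)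
    exact map_mem_commSet φ.toRingHom (comm_mem_commSet _ k)
  exact fun x hx => Ideal.mem_toTwoSided.1 (h hx)

theorem commSet_relFree_eq_zero {K : Type*} [Field K] (k : ℕ) :
    ∀ r ∈ commSet (RelFree K (k + 1)) k, r = 0 := by
  intro r hr
  obtain ⟨l, hl, rfl⟩ := exists_lift_commSet (f := (T K (k + 1) (F K)).ringCon.mk')
    (RingCon.mk'_surjective _) hr
  obtain ⟨a, rfl⟩ := exists_comm_eq hl
  have hmem : comm a (k + 1) ∈ T K (k + 1) (F K) := by
    refine TwoSidedIdeal.subset_span ⟨FreeAlgebra.lift K a, ?_⟩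
    refine (map_comm (FreeAlgebra.lift K a).toRingHom _ _).trans (comm_congr fun i _ => ?_)
    exact FreeAlgebra.lift_ι_apply a i
  exact (RingCon.eq _).2 ((TwoSidedIdeal.mem_iff _ _).1 hmem)

theorem adjoin_gen_F₃_eq_top (K : Type*) [Field K] (n : ℕ) :
    ∃ x y z : F₃ K n, Algebra.adjoin K {x, y, z} = ⊤ := by
  refine ⟨⟨RelFree.gen K n 0, Algebra.subset_adjoin (R := K) (by simp)⟩,
    ⟨RelFree.gen K n 1, Algebra.subset_adjoin (R := K) (by simp)⟩,
    ⟨RelFree.gen K n 2, Algebra.subset_adjoin (R := K) (by simp)⟩, ?_⟩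
  refine Eq.trans ?_ (Algebra.adjoin_adjoin_coe_preimage (R := K)
    (s := {RelFree.gen K n 0, RelFree.gen K n 1, RelFree.gen K n 2}))
  congr 1
  ext t
  simp only [Subtype.ext_iff, Set.mem_insert_iff, Set.mem_singleton_iff]
  exact Iff.rfl

end LieNilp

theorem mainTheorem10 {K : Type*} [Field K] [Infinite K]
    (h2 : (2 : K) ≠ 0) (h3 : (3 : K) ≠ 0) (n : ℕ) (hn : 3 ≤ n) :
    (LieNilp.T K (n - 1) (LieNilp.F₃ K n) : Set (LieNilp.F₃ K n)) ⊆
      Subalgebra.center K (LieNilp.F₃ K n) := by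
  -- Length m corresponds to `commSet` index m - 1, so n - 1 becomes index k + 1.
  obtain ⟨k, rfl⟩ : ∃ k, n = k + 3 := ⟨n - 3, by omega⟩
  obtain ⟨x, y, z, hA⟩ := LieNilp.adjoin_gen_F₃_eq_top K (k + 3)
  have h0 : ∀ r ∈ LieNilp.commSet (LieNilp.F₃ K (k + 3)) (k + 2), r = 0 := fun r hr =>
    Subtype.ext (LieNilp.commSet_relFree_eq_zero (k + 2) _
      (LieNilp.map_mem_commSet (LieNilp.F₃ K (k + 3)).val.toRingHom hr))
  intro t ht
  rw [SetLike.mem_coe, Subalgebra.mem_center_iff]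
  exact LieNilp.commute_of_mem_span h0 (LieNilp.lie_mul_mem_span_commSet h3 hA (k + 1))
    (LieNilp.T_subset_span (k + 1) ht)
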